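/- Let $\Lambda$ be a category of paths, that is, a small category, whose morphisms $\mu$ are called paths, with source $s(\mu)$ and range $r(\mu)$, with $\mu\nu$ defined when $s(\mu)=r(\nu)$, and with the objects (vertices) identified with the identity morphisms, such that for all $\alpha,\beta,\gamma\in\Lambda$ for which the products are defined: $\alpha\beta=\alpha\gamma$ implies $\beta=\gamma$; $\beta\alpha=\gamma\alpha$ implies $\beta=\gamma$; and $\alpha\beta=s(\beta)$ implies $\alpha=\beta=s(\beta)$. Let $\varphi:\Lambda\to\mathbb N^k$ be a degree functor, i.e. $\varphi(\mu\nu)=\varphi(\mu)+\varphi(\nu)$ whenever $s(\mu)=r(\nu)$, and suppose that $\varphi$ is non-degenerate, i.e. $\varphi(\alpha)\neq 0$ whenever $\alpha$ is not a vertex. Write $|\mu|$ for the sum of the coordinates of $\varphi(\mu)$. Let $\mathcal H_\Lambda$ be the complex Hilbert space with orthonormal basis $\{\xi_\nu\}_{\nu\in\Lambda}$ and, for $\mu\in\Lambda$, let $L_\mu$ be the bounded operator on $\mathcal H_\Lambda$ with $L_\mu\xi_\nu=\xi_{\mu\nu}$ if $s(\mu)=r(\nu)$ and $L_\mu\xi_\nu=0$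 otherwise. The left regular free semigroupoid algebra $\mathfrak L_\Lambda$ is the unital algebra, closed in the weak operator topology, generated by $\{L_\mu\}_{\mu\in\Lambda}$. It is called semisimple if its Jacobson radical is zero. A path $\mu$ is called minimal if $\mu=\nu\eta$ with $\nu,\eta\in\Lambda$ implies $\mu=\nu$ or $\mu=\eta$. Say that $\Lambda$ satisfies (P) if (i) for each vertex $v$, the set of minimal paths with range $v$ is finite; and (ii) if $A=a_1L_{w_1}+\dots+a_nL_{w_n}\neq 0$ with $a_i\in\mathbb C$, $w_i\in\Lambda$ and $|w_1|=\dots=|w_n|$, then there is some $\mu\in\Lambda$ such that $L_\mu A$ is not nilpotent. Then: (1) If $\Lambda$ satisfies (P), then $\mathfrak L_\Lambda$ is semisimple. (2) If $\mathfrak L_\Lambda$ is semisimple, then each path $\mu$ of $\Lambda$ lies on a cycle: there are $\alpha,\beta\in\Lambda$ such that $\alpha\mu\beta$ is defined and has the same source and range. (For a vertex this holds trivially, since a vertex counts as a cycle.) -/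

import Mathlib

open CategoryTheory

universe u v

/-- A path of the small category `V`, i.e. a morphism together with its source and range. -/
@[ext]
structure CatPath (V : Type u) [Category.{v} V] where
  source : V
  range : V
  hom : source ⟶ range

namespace CatPath

variable {V : Type u} [Category.{v} V]

/-- The vertex `x`, regarded as the identity path at `x`. -/
def vertex (x : V) : CatPath V := ⟨x, x, 𝟙 x⟩

/-- The path `μ` is a vertex, i.e. an identity morphism. -/
def IsVertex (μ : CatPath V) : Prop := ∃ x : V, μ = vertex x

/-- The concatenation `μν`, defined when `s(μ) = r(ν)`: first `ν`, then `μ`. -/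
def mul (μ ν : CatPath V) (h : μ.source = ν.range) : CatPath V :=
  ⟨ν.source, μ.range, ν.hom ≫ eqToHom h.symm ≫ μ.hom⟩

/-- A path is minimal if every factorization `μ = νη` has `μ = ν` or `μ = η`. -/
def IsMinimal (μ : CatPath V) : Prop :=
  ∀ (ν η : CatPath V) (h : ν.source = η.range), μ = ν.mul η h → μ = ν ∨ μ = η

/-- A cycle is a path whose source and range coincide. -/
def IsCycle (μ : CatPath V) : Prop := μ.source = μ.range

/-- The path `μ` lies on a cycle: there are paths `α`, `β` such that `αμβ` is defined and is a
cycle. -/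
def LiesOnCycle (μ : CatPath V) : Prop :=
  ∃ (α β : CatPath V) (h₁ : μ.source = β.range) (h₂ : α.source = (μ.mul β h₁).range),
    (α.mul (μ.mul β h₁) h₂).IsCycle

end CatPath

/-- Categories of paths: small categories with left cancellation, right cancellation and no
inverses. -/
class IsCategoryOfPaths (V : Type u) [Category.{v} V] : Prop where
  left_cancel : ∀ (α β γ : CatPath V) (hβ : α.source = β.range) (hγ : α.source = γ.range),
    α.mul β hβ = α.mul γ hγ → β = γ
  right_cancel : ∀ (α β γ : CatPath V) (hβ : β.source = α.range) (hγ : γ.source = α.range),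
    β.mul α hβ = γ.mul α hγ → β = γ
  no_inverses : ∀ (α β : CatPath V) (h : α.source = β.range),
    α.mul β h = CatPath.vertex β.source →
      α = CatPath.vertex β.source ∧ β = CatPath.vertex β.source

namespace CatPath

/-- The Fock space: the square-summable complex functions on the set of paths. -/
abbrev Fock (V : Type u) [Category.{v} V] : Type (max u v) := lp (fun _ : CatPath V => ℂ) 2

variable {V : Type u} [Category.{v} V]

open Classical in
/-- The standard orthonormal basis vector `ξ_μ` of the Fock space. -/
noncomputable def ξ (μ : CatPath V) : Fock V := lp.single 2 μ (1 : ℂ)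

open Classical in
/-- The function with value `f ν` at `μν` and value `0` off the paths that begin with `μ`. -/
noncomputable def shiftFun (μ : CatPath V) (f : CatPath V → ℂ) (η : CatPath V) : ℂ :=
  if h : ∃ ν : CatPath V, ∃ h : μ.source = ν.range, μ.mul ν h = η then f h.choose else 0

theorem shiftFun_add (μ : CatPath V) (f g : CatPath V → ℂ) :
    shiftFun μ (f + g) = shiftFun μ f + shiftFun μ g := by
  funext η
  by_cases h : ∃ ν : CatPath V, ∃ h : μ.source = ν.range, μ.mul ν h = η <;> simp [shiftFun, h]

theorem shiftFun_smul (μ : CatPath V) (c : ℂ) (f : CatPath V → ℂ) :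
    shiftFun μ (c • f) = c • shiftFun μ f := by
  funext η
  by_cases h : ∃ ν : CatPath V, ∃ h : μ.source = ν.range, μ.mul ν h = η <;> simp [shiftFun, h]

theorem shiftFun_mul [IsCategoryOfPaths V] (μ ν : CatPath V) (h : μ.source = ν.range)
    (f : CatPath V → ℂ) : shiftFun μ f (μ.mul ν h) = f ν := by
  have H : ∃ ν' : CatPath V, ∃ h' : μ.source = ν'.range, μ.mul ν' h' = μ.mul ν h := ⟨ν, h, rfl⟩
  obtain ⟨h', e⟩ := H.choose_spec
  rw [shiftFun, dif_pos H, IsCategoryOfPaths.left_cancel μ H.choose ν h' h e]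

theorem sum_shiftFun_le (μ : CatPath V) (f : Fock V) (s : Finset (CatPath V)) :
    ∑ η ∈ s, ‖shiftFun μ f η‖ ^ (2 : ENNReal).toReal ≤ ‖f‖ ^ (2 : ENNReal).toReal := by
  classical
  let P : CatPath V → Prop := fun η => ∃ ν : CatPath V, ∃ h : μ.source = ν.range, μ.mul ν h = η
  let c : CatPath V → CatPath V := fun η => if h : P η then h.choose else η
  have hc : ∀ η, P η → ∃ h : μ.source = (c η).range, μ.mul (c η) h = η := by
    intro η hη
    have := hη.choose_spec
    simpa only [c, dif_pos hη] using this
  have hs : ∀ η, P η → shiftFun μ f η = f (c η) := by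
    intro η hη
    simp only [c, dif_pos hη]
    exact dif_pos hη
  have h0 : ∀ η, ¬ P η → shiftFun μ f η = 0 := fun η hη => dif_neg hη
  have h1 : ∑ η ∈ s, ‖shiftFun μ f η‖ ^ (2 : ENNReal).toReal
      = ∑ η ∈ s.filter P, ‖f (c η)‖ ^ (2 : ENNReal).toReal := by
    rw [Finset.sum_filter]
    refine Finset.sum_congr rfl fun η _ => ?_
    by_cases hη : P η
    · rw [if_pos hη, hs η hη]
    · rw [if_neg hη, h0 η hη]
      simp
  have hinj : Set.InjOn c (s.filter P : Finset (CatPath V)) := by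
    intro a ha b hb hab
    obtain ⟨ha1, ha2⟩ := hc a (Finset.mem_filter.1 ha).2
    obtain ⟨hb1, hb2⟩ := hc b (Finset.mem_filter.1 hb).2
    rw [← ha2, ← hb2]
    simp only [hab]
  rw [h1, ← Finset.sum_image (f := fun ν => ‖f ν‖ ^ (2 : ENNReal).toReal) hinj]
  exact lp.sum_rpow_le_norm_rpow (by norm_num) f _

/-- The operator `L_μ` on the Fock space; see `L_ξ` and `L_ξ_of_ne` for its values on the
orthonormal basis. -/
noncomputable def L (μ : CatPath V) : Fock V →L[ℂ] Fock V :=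
  LinearMap.mkContinuous
    { toFun := fun f => ⟨shiftFun μ f, memℓp_gen' (sum_shiftFun_le μ f)⟩
      map_add' := fun f g => Subtype.ext (shiftFun_add μ f g)
      map_smul' := fun a f => Subtype.ext (shiftFun_smul μ a f) }
    1
    (fun f => by
      rw [one_mul]
      exact lp.norm_le_of_forall_sum_le (by norm_num) (norm_nonneg f) (sum_shiftFun_le μ f))

theorem L_apply (μ : CatPath V) (f : Fock V) (η : CatPath V) : L μ f η = shiftFun μ f η := rfl

theorem L_ξ [IsCategoryOfPaths V] (μ ν : CatPath V) (h : μ.source = ν.range) :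
    L μ (ξ ν) = ξ (μ.mul ν h) := by
  classical
  ext η
  rw [L_apply]
  by_cases hη : ∃ ν' : CatPath V, ∃ h' : μ.source = ν'.range, μ.mul ν' h' = η
  · obtain ⟨ν', h', rfl⟩ := hη
    rw [shiftFun_mul]
    by_cases e : ν' = ν
    · subst e
      simp [ξ]
    · have e' : μ.mul ν' h' ≠ μ.mul ν h := fun q =>
        e (IsCategoryOfPaths.left_cancel μ ν' ν h' h q)
      simp [ξ, lp.single_apply, e, e']
  · have e' : η ≠ μ.mul ν h := fun q => hη ⟨ν, h, q.symm⟩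
    rw [shiftFun, dif_neg hη]
    simp [ξ, lp.single_apply, e']

theorem L_ξ_of_ne (μ ν : CatPath V) (h : μ.source ≠ ν.range) : L μ (ξ ν) = 0 := by
  classical
  ext η
  rw [L_apply, shiftFun]
  split_ifs with hη
  · obtain ⟨h', -⟩ := hη.choose_spec
    have e : hη.choose ≠ ν := fun q => h (by rw [h', q])
    simp [ξ, lp.single_apply, e]
  · simp

/-- A subalgebra of bounded operators is closed in the weak operator topology. -/
def IsWOTClosed {H : Type*} [NormedAddCommGroup H] [InnerProductSpace ℂ H]
    (S : Subalgebra ℂ (H →L[ℂ] H)) : Prop :=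
  IsClosed {A : H →WOT[ℂ] H | ContinuousLinearMapWOT.toCLM A ∈ S}

variable (V) in
/-- The left regular free semigroupoid algebra: the smallest WOT-closed subalgebra of the bounded
operators on the Fock space that contains all `L_μ`. -/
noncomputable def freeSemigroupoidAlgebra : Subalgebra ℂ (Fock V →L[ℂ] Fock V) :=
  sInf {S | (∀ μ : CatPath V, L μ ∈ S) ∧ IsWOTClosed S}

end CatPath

/-- A degree functor with values in `ℕ^k`. -/
structure DegreeFunctor (V : Type u) [Category.{v} V] (k : ℕ) where
  toFun : CatPath V → Fin k → ℕ
  map_mul : ∀ (μ ν : CatPath V) (h : μ.source = ν.range),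
    toFun (μ.mul ν h) = toFun μ + toFun ν

namespace DegreeFunctor

variable {V : Type u} [Category.{v} V] {k : ℕ}

/-- Only vertices have degree zero. -/
def NonDegenerate (φ : DegreeFunctor V k) : Prop :=
  ∀ α : CatPath V, ¬ α.IsVertex → φ.toFun α ≠ 0

/-- The length `|μ|`: the sum of the coordinates of the degree of `μ`. -/
def length (φ : DegreeFunctor V k) (μ : CatPath V) : ℕ := ∑ i, φ.toFun μ i

/-- Property (P), with respect to the lengths given by the degree functor. -/
structure PropertyP (φ : DegreeFunctor V k) : Prop where
  finite_minimal : ∀ x : V, {μ : CatPath V | μ.range = x ∧ μ.IsMinimal}.Finite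
  exists_not_nilpotent : ∀ (n : ℕ) (a : Fin n → ℂ) (w : Fin n → CatPath V),
    (∀ i j, φ.length (w i) = φ.length (w j)) →
    (∑ i, a i • CatPath.L (w i)) ≠ 0 →
    ∃ μ : CatPath V, ¬ IsNilpotent (CatPath.L μ * ∑ i, a i • CatPath.L (w i))

end DegreeFunctor

/-!
# Semisimplicity of free semigroupoid algebras

Write `𝔏` for the free semigroupoid algebra and `J` for its Jacobson radical. As `𝔏` commutes with
the right shifts (`CatPath.commute_R_of_mem`), an element of `𝔏` is determined by its Fourier
coefficients `a_w = ⟨A ξ_{s(w)}, ξ_w⟩`, and `A ξ_ν` is supported on the paths `wν`.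

If `μ` lies on no cycle, it follows that `L_μ A L_μ = 0` for all `A ∈ 𝔏`. So the left ideal
generated by `L_μ` consists of square-zero elements, and `0 ≠ L_μ ∈ J`. This is the second half of
the theorem.

For the first half, suppose `J ≠ 0`. Elements of `J` are quasinilpotent. As only finitely many paths
of a given length end at a given vertex, some element of `J` has a leading term (its part of least
length) that is a nonzero finite combination of operators `L_w` with `|w| = d`
(`DegreeFunctor.exists_hasLeadingSum`). Leading terms form an ideal, and they are quasinilpotent on
the basis vectors, because truncation to the lowest degree does not increase norms there. This alone
does not contradict property (P), as no lower bound is available for the nonzero coefficients of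
the powers of a homogeneous operator with transcendental coefficients. The way around is to compare
with Gaussian integer coefficients. A Gaussian integer combination of the `L_w` maps basis vectors to vectors with
Gaussian integer coordinates, so it is nilpotent as soon as its powers tend to zero on the basis
vectors, uniformly.

Choose a nonzero leading term `D = ∑_{j ∈ s} β_j y_j`, with `y_j` a Gaussian integer combination of
the `L_w`, `|w| = d`, and with as few summands as possible. Then `D L_u y_j = y_j L_u D` for all
paths `u`, since the difference is a leading term with fewer summands
(`DegreeFunctor.mul_mul_eq_of_minimal`). By simultaneous approximation (`exists_gaussian_approx`)
there are Gaussian integers `q_j`, not all zero, and `c ∈ ℂ` such that all `q_j - c β_j` are small.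
Put `Q = ∑ q_j y_j`. For every path `μ`, the operator `L_μ Q` is the sum of `c L_μ D`, which is a
leading term of the radical, and a small operator that commutes with it; hence `L_μ Q` is nilpotent
(`DegreeFunctor.IsLeading.isNilpotent_add`). Property (P) gives `Q = 0`, and this linear relation
eliminates a summand from `D`, which contradicts the choice of `D`.
-/

/-! ### Paths and lengths -/

namespace CatPath

variable {V : Type u} [Category.{v} V]

theorem mul_assoc' (α β γ : CatPath V) (h₁ : α.source = β.range) (h₂ : β.source = γ.range) :
    α.mul (β.mul γ h₂) h₁ = (α.mul β h₁).mul γ h₂ := by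
  rcases α with ⟨a, b, f⟩
  rcases β with ⟨c, d, g⟩
  rcases γ with ⟨x, y, k⟩
  obtain rfl : a = d := h₁
  obtain rfl : c = y := h₂
  change CatPath.mk x b ((k ≫ 𝟙 c ≫ g) ≫ 𝟙 a ≫ f) = CatPath.mk x b (k ≫ 𝟙 c ≫ g ≫ 𝟙 a ≫ f)
  simp

theorem mul_vertex (μ : CatPath V) : μ.mul (vertex μ.source) rfl = μ := by
  simp [mul, vertex]

theorem vertex_mul (μ : CatPath V) : (vertex μ.range).mul μ rfl = μ := by
  simp [mul, vertex]

/-- A path `μ` for which some `μνμ` is defined lies on a cycle. -/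
theorem LiesOnCycle.of_return {μ ν : CatPath V} (h₁ : μ.source = ν.range)
    (h₂ : ν.source = μ.range) : μ.LiesOnCycle :=
  ⟨ν, vertex μ.source, rfl, h₂, h₁⟩

end CatPath

namespace DegreeFunctor

open CatPath

variable {V : Type u} [Category.{v} V] {k : ℕ} (φ : DegreeFunctor V k)

theorem length_mul (μ ν : CatPath V) (h : μ.source = ν.range) :
    φ.length (μ.mul ν h) = φ.length μ + φ.length ν := by
  simp [length, φ.map_mul μ ν h, Finset.sum_add_distrib]

variable {φ} in
theorem NonDegenerate.isVertex_of_length_eq_zero (hφ : φ.NonDegenerate) {μ : CatPath V}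
    (h : φ.length μ = 0) : μ.IsVertex := by
  by_contra hμ
  refine hφ μ hμ (funext fun i => ?_)
  exact Finset.sum_eq_zero_iff.1 h i (Finset.mem_univ i)

variable {φ} in
/-- Every path of positive length begins with a minimal path of positive length. -/
theorem NonDegenerate.exists_minimal_factor (hφ : φ.NonDegenerate) (μ : CatPath V)
    (hμ : 0 < φ.length μ) :
    ∃ (ν η : CatPath V) (h : ν.source = η.range),
      ν.IsMinimal ∧ 0 < φ.length ν ∧ μ = ν.mul η h := by
  induction hn : φ.length μ using Nat.strong_induction_on generalizing μ with
  | _ n ih =>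
    by_cases hm : μ.IsMinimal
    · exact ⟨μ, vertex μ.source, rfl, hm, hμ, (mul_vertex μ).symm⟩
    · simp only [IsMinimal, not_forall, not_or] at hm
      obtain ⟨ν, η, h, e, h₁, h₂⟩ := hm
      have hl : φ.length μ = φ.length ν + φ.length η := by rw [e, φ.length_mul]
      have hη : 0 < φ.length η := by
        by_contra h0
        obtain ⟨x, rfl⟩ := hφ.isVertex_of_length_eq_zero (Nat.eq_zero_of_not_pos h0)
        obtain rfl : ν.source = x := h
        exact h₁ (e.trans (mul_vertex ν))
      have hν : 0 < φ.length ν := by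
        by_contra h0
        obtain ⟨x, rfl⟩ := hφ.isVertex_of_length_eq_zero (Nat.eq_zero_of_not_pos h0)
        obtain rfl : x = η.range := h
        exact h₂ (e.trans (vertex_mul η))
      obtain ⟨ν', η', h', hm', hν', rfl⟩ := ih (φ.length ν) (by omega) ν hν rfl
      exact ⟨ν', η'.mul η h, h', hm', hν', e.trans (mul_assoc' ν' η' η h' h).symm⟩

variable {φ} in
/-- If only finitely many minimal paths end at each vertex, then only finitely many paths of a
given length do. -/
theorem NonDegenerate.finite_setOf_length_eq (hφ : φ.NonDegenerate)
    (hfin : ∀ x : V, {μ : CatPath V | μ.range = x ∧ μ.IsMinimal}.Finite) (d : ℕ) (x : V) :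
    {μ : CatPath V | μ.range = x ∧ φ.length μ = d}.Finite := by
  induction d using Nat.strong_induction_on generalizing x with
  | _ d ih =>
    rcases Nat.eq_zero_or_pos d with rfl | hd
    · refine (Set.finite_singleton (vertex x)).subset ?_
      rintro μ ⟨hr, hl⟩
      obtain ⟨y, rfl⟩ := hφ.isVertex_of_length_eq_zero hl
      obtain rfl : y = x := hr
      rfl
    · let F : CatPath V → CatPath V → CatPath V := fun ν η => by
        classical exact if h : ν.source = η.range then ν.mul η h else ν
      have hF : (⋃ ν ∈ {μ : CatPath V | μ.range = x ∧ μ.IsMinimal}, ⋃ e ∈ Set.Iio d,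
          F ν '' {η | η.range = ν.source ∧ φ.length η = e}).Finite :=
        (hfin x).biUnion fun ν _ => (Set.finite_Iio d).biUnion fun e he => (ih e he _).image _
      refine hF.subset ?_
      rintro μ ⟨hr, hl⟩
      obtain ⟨ν, η, h, hm, hν, rfl⟩ := hφ.exists_minimal_factor μ (by omega)
      rw [φ.length_mul] at hl
      simp only [Set.mem_iUnion]
      exact ⟨ν, ⟨hr, hm⟩, φ.length η, Set.mem_Iio.2 (by omega), η, ⟨h.symm, rfl⟩, dif_pos h⟩

end DegreeFunctor

/-! ### Coordinates on the Fock space -/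

namespace CatPath

variable {V : Type u} [Category.{v} V]

theorem ξ_apply_self (μ : CatPath V) : ξ μ μ = 1 := by
  classical simp [ξ]

theorem ξ_apply_of_ne {μ ν : CatPath V} (h : ν ≠ μ) : ξ μ ν = 0 := by
  classical simp [ξ, lp.single_apply, h]

theorem ξ_ne_zero (μ : CatPath V) : ξ μ ≠ 0 := fun h => by
  have := ξ_apply_self μ
  rw [h] at this
  simp at this

theorem norm_ξ (μ : CatPath V) : ‖ξ μ‖ = 1 := by
  classical rw [ξ, lp.norm_single (by norm_num), norm_one]

theorem hasSum_ξ (f : Fock V) : HasSum (fun μ => f μ • ξ μ) f := by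
  classical
  convert lp.hasSum_single (p := 2) (by norm_num) f using 2 with μ
  rw [ξ, ← lp.single_smul, smul_eq_mul, mul_one]

/-- The matrix entries of a bounded operator: `A f` at `η` is `∑ f(ν) ⟨A ξ_ν, ξ_η⟩`. -/
theorem hasSum_apply (A : Fock V →L[ℂ] Fock V) (f : Fock V) (η : CatPath V) :
    HasSum (fun ν => f ν * A (ξ ν) η) (A f η) := by
  have h := (hasSum_ξ f).mapL ((lp.evalCLM ℂ (fun _ : CatPath V => ℂ) 2 η).comp A)
  simp only [map_smul] at h
  exact h

theorem ext_ξ {A B : Fock V →L[ℂ] Fock V} (h : ∀ ν, A (ξ ν) = B (ξ ν)) : A = B := by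
  ext f η
  have hA := hasSum_apply A f η
  simp only [h] at hA
  exact hA.unique (hasSum_apply B f η)

theorem continuous_wot_apply (f : Fock V) (η : CatPath V) :
    Continuous fun A : Fock V →WOT[ℂ] Fock V => A f η :=
  ContinuousLinearMapWOT.continuous_dual_apply f (lp.evalCLM ℂ (fun _ : CatPath V => ℂ) 2 η)

theorem L_apply_mul [IsCategoryOfPaths V] (μ ν : CatPath V) (h : μ.source = ν.range)
    (f : Fock V) : L μ f (μ.mul ν h) = f ν :=
  shiftFun_mul μ ν h f

theorem L_apply_of_forall_ne (μ η : CatPath V) (f : Fock V)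
    (h : ∀ (ν : CatPath V) (h : μ.source = ν.range), μ.mul ν h ≠ η) : L μ f η = 0 := by
  rw [L_apply, shiftFun, dif_neg]
  rintro ⟨ν, h', e⟩
  exact h ν h' e

theorem norm_L_le (μ : CatPath V) : ‖L μ‖ ≤ 1 :=
  LinearMap.mkContinuous_norm_le _ zero_le_one _

theorem L_ξ_apply_of_forall_ne [IsCategoryOfPaths V] (w ν κ : CatPath V)
    (h : ∀ h : w.source = ν.range, w.mul ν h ≠ κ) : L w (ξ ν) κ = 0 := by
  by_cases hs : w.source = ν.range
  · rw [L_ξ w ν hs, ξ_apply_of_ne (h hs).symm]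
  · rw [L_ξ_of_ne w ν hs]
    rfl

theorem sum_smul_L_apply (W : Finset (CatPath V)) (a : CatPath V → ℂ) (ν κ : CatPath V) :
    (∑ w ∈ W, a w • L w) (ξ ν) κ = ∑ w ∈ W, a w * L w (ξ ν) κ := by
  rw [sum_apply]
  exact map_sum (lp.evalCLM ℂ (fun _ : CatPath V => ℂ) 2 κ) (fun w => a w • L w (ξ ν)) W

open Classical in
theorem sum_smul_L_apply_mul [IsCategoryOfPaths V] (W : Finset (CatPath V)) (a : CatPath V → ℂ)
    (w ν : CatPath V) (h : w.source = ν.range) :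
    (∑ z ∈ W, a z • L z) (ξ ν) (w.mul ν h) = if w ∈ W then a w else 0 := by
  have h1 : ∀ z ∈ W, a z * L z (ξ ν) (w.mul ν h) = if z = w then a w else 0 := by
    intro z _
    split_ifs with hz
    · subst hz
      rw [L_ξ z ν h, ξ_apply_self, mul_one]
    · rw [L_ξ_apply_of_forall_ne z ν _ fun hs q =>
        hz (IsCategoryOfPaths.right_cancel ν z w hs h q), mul_zero]
  rw [sum_smul_L_apply, Finset.sum_congr rfl h1, Finset.sum_ite_eq' W w]

theorem L_mul_L [IsCategoryOfPaths V] (μ ν : CatPath V) (h : μ.source = ν.range) :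
    L μ * L ν = L (μ.mul ν h) := by
  refine ext_ξ fun η => ?_
  rw [mul_apply_eq_comp]
  by_cases hη : ν.source = η.range
  · rw [L_ξ ν η hη, L_ξ μ (ν.mul η hη) h, L_ξ (μ.mul ν h) η hη, mul_assoc' μ ν η h hη]
  · rw [L_ξ_of_ne ν η hη, L_ξ_of_ne (μ.mul ν h) η hη, map_zero]

theorem L_mul_L_of_ne [IsCategoryOfPaths V] (μ ν : CatPath V) (h : μ.source ≠ ν.range) :
    L μ * L ν = 0 := by
  refine ext_ξ fun η => ?_
  rw [mul_apply_eq_comp]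
  by_cases hη : ν.source = η.range
  · rw [L_ξ ν η hη, L_ξ_of_ne μ (ν.mul η hη) h, zero_apply]
  · rw [L_ξ_of_ne ν η hη, map_zero, zero_apply]

theorem L_ne_zero [IsCategoryOfPaths V] (μ : CatPath V) : L μ ≠ 0 := fun h => by
  have := L_ξ μ (vertex μ.source) rfl
  rw [h] at this
  exact ξ_ne_zero _ this.symm

/-! ### Right shifts and the commutant -/

open Classical in
/-- The function with value `f ν` at `νμ` and value `0` off the paths that end with `μ`. -/
noncomputable def rightShiftFun (μ : CatPath V) (f : CatPath V → ℂ) (η : CatPath V) : ℂ :=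
  if h : ∃ ν : CatPath V, ∃ h : ν.source = μ.range, ν.mul μ h = η then f h.choose else 0

theorem rightShiftFun_mul [IsCategoryOfPaths V] (μ ν : CatPath V) (h : ν.source = μ.range)
    (f : CatPath V → ℂ) : rightShiftFun μ f (ν.mul μ h) = f ν := by
  have H : ∃ ν' : CatPath V, ∃ h' : ν'.source = μ.range, ν'.mul μ h' = ν.mul μ h := ⟨ν, h, rfl⟩
  obtain ⟨h', e⟩ := H.choose_spec
  rw [rightShiftFun, dif_pos H, IsCategoryOfPaths.right_cancel μ H.choose ν h' h e]

theorem rightShiftFun_of_forall_ne (μ η : CatPath V) (f : CatPath V → ℂ)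
    (h : ∀ (ν : CatPath V) (h : ν.source = μ.range), ν.mul μ h ≠ η) :
    rightShiftFun μ f η = 0 := by
  rw [rightShiftFun, dif_neg]
  rintro ⟨ν, h', e⟩
  exact h ν h' e

theorem rightShiftFun_add (μ : CatPath V) (f g : CatPath V → ℂ) :
    rightShiftFun μ (f + g) = rightShiftFun μ f + rightShiftFun μ g := by
  funext η
  by_cases h : ∃ ν : CatPath V, ∃ h : ν.source = μ.range, ν.mul μ h = η <;>
    simp [rightShiftFun, h]

theorem rightShiftFun_smul (μ : CatPath V) (c : ℂ) (f : CatPath V → ℂ) :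
    rightShiftFun μ (c • f) = c • rightShiftFun μ f := by
  funext η
  by_cases h : ∃ ν : CatPath V, ∃ h : ν.source = μ.range, ν.mul μ h = η <;>
    simp [rightShiftFun, h]

theorem sum_rightShiftFun_le (μ : CatPath V) (f : Fock V) (s : Finset (CatPath V)) :
    ∑ η ∈ s, ‖rightShiftFun μ f η‖ ^ (2 : ENNReal).toReal ≤ ‖f‖ ^ (2 : ENNReal).toReal := by
  classical
  let P : CatPath V → Prop := fun η => ∃ ν : CatPath V, ∃ h : ν.source = μ.range, ν.mul μ h = η
  let c : CatPath V → CatPath V := fun η => if h : P η then h.choose else η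
  have hc : ∀ η, P η → ∃ h : (c η).source = μ.range, (c η).mul μ h = η := by
    intro η hη
    have := hη.choose_spec
    simpa only [c, dif_pos hη] using this
  have h1 : ∑ η ∈ s, ‖rightShiftFun μ f η‖ ^ (2 : ENNReal).toReal
      = ∑ η ∈ s.filter P, ‖f (c η)‖ ^ (2 : ENNReal).toReal := by
    rw [Finset.sum_filter]
    refine Finset.sum_congr rfl fun η _ => ?_
    by_cases hη : P η
    · rw [if_pos hη, rightShiftFun, dif_pos hη]
      simp only [c, dif_pos hη]
    · rw [if_neg hη, rightShiftFun, dif_neg hη]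
      simp
  have hinj : Set.InjOn c (s.filter P : Finset (CatPath V)) := by
    intro a ha b hb hab
    obtain ⟨_, ha2⟩ := hc a (Finset.mem_filter.1 ha).2
    obtain ⟨_, hb2⟩ := hc b (Finset.mem_filter.1 hb).2
    rw [← ha2, ← hb2]
    simp only [hab]
  rw [h1, ← Finset.sum_image (f := fun ν => ‖f ν‖ ^ (2 : ENNReal).toReal) hinj]
  exact lp.sum_rpow_le_norm_rpow (by norm_num) f _

/-- The right shift by `μ`, which maps `ξ_ν` to `ξ_{νμ}` if `s(ν) = r(μ)` and to `0` otherwise. -/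
noncomputable def R (μ : CatPath V) : Fock V →L[ℂ] Fock V :=
  LinearMap.mkContinuous
    { toFun := fun f => ⟨rightShiftFun μ f, memℓp_gen' (sum_rightShiftFun_le μ f)⟩
      map_add' := fun f g => Subtype.ext (rightShiftFun_add μ f g)
      map_smul' := fun a f => Subtype.ext (rightShiftFun_smul μ a f) }
    1
    (fun f => by
      rw [one_mul]
      exact lp.norm_le_of_forall_sum_le (by norm_num) (norm_nonneg f) (sum_rightShiftFun_le μ f))

theorem R_apply (μ : CatPath V) (f : Fock V) (η : CatPath V) :
    R μ f η = rightShiftFun μ f η := rfl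

theorem R_ξ [IsCategoryOfPaths V] (μ ν : CatPath V) (h : ν.source = μ.range) :
    R μ (ξ ν) = ξ (ν.mul μ h) := by
  ext η
  rw [R_apply]
  by_cases hη : ∃ ν' : CatPath V, ∃ h' : ν'.source = μ.range, ν'.mul μ h' = η
  · obtain ⟨ν', h', rfl⟩ := hη
    rw [rightShiftFun_mul]
    by_cases e : ν' = ν
    · subst e
      rw [ξ_apply_self, ξ_apply_self]
    · rw [ξ_apply_of_ne e, ξ_apply_of_ne fun q =>
        e (IsCategoryOfPaths.right_cancel μ ν' ν h' h q)]
  · rw [rightShiftFun, dif_neg hη, ξ_apply_of_ne fun q => hη ⟨ν, h, q.symm⟩]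

theorem R_ξ_of_ne (μ ν : CatPath V) (h : ν.source ≠ μ.range) : R μ (ξ ν) = 0 := by
  ext η
  rw [R_apply, rightShiftFun]
  split_ifs with hη
  · obtain ⟨h', -⟩ := hη.choose_spec
    exact ξ_apply_of_ne fun q => h (by rw [← q, h'])
  · simp

theorem commute_L_R [IsCategoryOfPaths V] (μ ν : CatPath V) : Commute (R ν) (L μ) := by
  refine ext_ξ fun η => ?_
  simp only [mul_apply_eq_comp]
  by_cases h₁ : μ.source = η.range <;> by_cases h₂ : η.source = ν.range
  · rw [L_ξ μ η h₁, R_ξ ν η h₂, R_ξ ν (μ.mul η h₁) h₂, L_ξ μ (η.mul ν h₂) h₁,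
      mul_assoc' μ η ν h₁ h₂]
  · rw [L_ξ μ η h₁, R_ξ_of_ne ν η h₂, R_ξ_of_ne ν (μ.mul η h₁) h₂, map_zero]
  · rw [L_ξ_of_ne μ η h₁, R_ξ ν η h₂, L_ξ_of_ne μ (η.mul ν h₂) h₁, map_zero]
  · rw [L_ξ_of_ne μ η h₁, R_ξ_of_ne ν η h₂, map_zero, map_zero]

theorem L_mem_freeSemigroupoidAlgebra (μ : CatPath V) : L μ ∈ freeSemigroupoidAlgebra V :=
  Algebra.mem_sInf.2 fun _ hS => hS.1 μ

theorem freeSemigroupoidAlgebra_le {S : Subalgebra ℂ (Fock V →L[ℂ] Fock V)}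
    (hL : ∀ μ, L μ ∈ S) (hS : IsWOTClosed S) : freeSemigroupoidAlgebra V ≤ S :=
  sInf_le ⟨hL, hS⟩

/-- The free semigroupoid algebra lies in the commutant of the right shifts. -/
theorem commute_R_of_mem [IsCategoryOfPaths V] {A : Fock V →L[ℂ] Fock V}
    (hA : A ∈ freeSemigroupoidAlgebra V) (ν : CatPath V) : Commute (R ν) A := by
  have key : freeSemigroupoidAlgebra V ≤ Subalgebra.centralizer ℂ (Set.range R) := by
    refine freeSemigroupoidAlgebra_le (fun μ => ?_) ?_
    · rintro _ ⟨ν, rfl⟩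
      exact commute_L_R μ ν
    · have e : {B : Fock V →WOT[ℂ] Fock V |
            ContinuousLinearMapWOT.toCLM B ∈ Subalgebra.centralizer ℂ (Set.range (R (V := V)))}
          = ⋂ (ν : CatPath V) (f : Fock V) (η : CatPath V),
            {B : Fock V →WOT[ℂ] Fock V | R ν (B f) η = B (R ν f) η} := by
        ext B
        simp only [Set.mem_ofPred_eq, Set.mem_iInter, Subalgebra.mem_centralizer_iff,
          Set.forall_mem_range]
        refine forall_congr' fun ν => ⟨fun h f η => ?_, fun h => ?_⟩
        · exact congrArg (fun g : Fock V => g η) (DFunLike.congr_fun h f)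
        · ext f η
          exact h f η
      rw [IsWOTClosed, e]
      refine isClosed_iInter fun ν => isClosed_iInter fun f => isClosed_iInter fun η => ?_
      exact isClosed_eq (ContinuousLinearMapWOT.continuous_dual_apply f
        ((lp.evalCLM ℂ (fun _ : CatPath V => ℂ) 2 η).comp (R ν))) (continuous_wot_apply _ η)
  exact key hA _ ⟨ν, rfl⟩

theorem apply_ξ_eq_R [IsCategoryOfPaths V] {A : Fock V →L[ℂ] Fock V}
    (hA : A ∈ freeSemigroupoidAlgebra V) (ν : CatPath V) :
    A (ξ ν) = R ν (A (ξ (vertex ν.range))) := by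
  conv_lhs => rw [← vertex_mul ν, ← R_ξ ν (vertex ν.range) rfl]
  exact (DFunLike.congr_fun (commute_R_of_mem hA ν) _).symm

/-- The Fourier coefficient of an element of the free semigroupoid algebra at `w` governs all
matrix entries from `ξ_ν` to `ξ_{wν}`. -/
theorem apply_ξ_mul [IsCategoryOfPaths V] {A : Fock V →L[ℂ] Fock V}
    (hA : A ∈ freeSemigroupoidAlgebra V) (w ν : CatPath V) (h : w.source = ν.range) :
    A (ξ ν) (w.mul ν h) = A (ξ (vertex w.source)) w := by
  rw [apply_ξ_eq_R hA, R_apply, rightShiftFun_mul, h]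

theorem apply_ξ_of_forall_ne [IsCategoryOfPaths V] {A : Fock V →L[ℂ] Fock V}
    (hA : A ∈ freeSemigroupoidAlgebra V) (ν η : CatPath V)
    (h : ∀ (w : CatPath V) (h : w.source = ν.range), w.mul ν h ≠ η) : A (ξ ν) η = 0 := by
  rw [apply_ξ_eq_R hA, R_apply, rightShiftFun_of_forall_ne ν η _ h]

/-- A path that lies on no cycle generates a left ideal of square-zero elements. -/
theorem L_mul_mul_L_eq_zero [IsCategoryOfPaths V] {μ : CatPath V} (hμ : ¬ μ.LiesOnCycle)
    {A : Fock V →L[ℂ] Fock V} (hA : A ∈ freeSemigroupoidAlgebra V) : L μ * A * L μ = 0 := by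
  refine ext_ξ fun η => ?_
  simp only [mul_apply_eq_comp, zero_apply]
  by_cases hη : μ.source = η.range
  swap
  · rw [L_ξ_of_ne μ η hη, map_zero, map_zero]
  rw [L_ξ μ η hη]
  ext κ
  by_cases hκ : ∃ ν : CatPath V, ∃ h : μ.source = ν.range, μ.mul ν h = κ
  · obtain ⟨ν, h, rfl⟩ := hκ
    rw [L_apply_mul]
    refine apply_ξ_of_forall_ne hA _ _ fun w hw e => hμ ?_
    subst e
    exact .of_return (ν := w) h hw
  · exact L_apply_of_forall_ne _ _ _ fun ν h e => hκ ⟨ν, h, e⟩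

end CatPath

/-! ### The Jacobson radical of an algebra of operators -/

theorem Ring.mem_jacobson_of_forall_mul_mul_eq_zero {A : Type*} [Ring A] {x : A}
    (hx : ∀ y, x * y * x = 0) : x ∈ Ring.jacobson A := by
  rw [← Ideal.jacobson_bot, Ideal.mem_jacobson_iff]
  refine fun y => ⟨1 - y * x, (Submodule.mem_bot A).2 ?_⟩
  have e : (1 - y * x) * y * x + (1 - y * x) - 1 = -(y * (x * y * x)) := by noncomm_ring
  rw [e, hx, mul_zero, neg_zero]

theorem Ring.isUnit_one_sub_of_mem_jacobson {A : Type*} [Ring A] {x : A}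
    (hx : x ∈ Ring.jacobson A) : IsUnit (1 - x) := by
  -- Every `1 - y` with `y` in the radical has a left inverse, which is again of this form.
  have left : ∀ y ∈ Ring.jacobson A, ∃ z, z * (1 - y) = 1 := by
    intro y hy
    rw [← Ideal.jacobson_bot, Ideal.mem_jacobson_iff] at hy
    obtain ⟨z, hz⟩ := hy (-1)
    refine ⟨z, ?_⟩
    rw [Submodule.mem_bot] at hz
    rw [← sub_eq_zero, ← hz]
    noncomm_ring
  obtain ⟨z, hz⟩ := left x hx
  have e : 1 - -(z * x) = z := by
    rw [mul_sub, mul_one] at hz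
    rw [← hz]
    abel
  obtain ⟨t, ht⟩ := left (-(z * x)) (neg_mem (Ideal.mul_mem_left _ z hx))
  rw [e] at ht
  have ht' : t = 1 - x := by
    calc t = t * (z * (1 - x)) := by rw [hz, mul_one]
      _ = 1 - x := by rw [← mul_assoc, ht, one_mul]
  exact ⟨⟨1 - x, z, ht' ▸ ht, hz⟩, rfl⟩

/-- Elements of the radical of a subalgebra of a Banach algebra are quasinilpotent. The subalgebra
need not be closed, as a unit of the subalgebra is a unit of the Banach algebra. -/
theorem eventually_norm_pow_le_of_mem_jacobson {B : Type*} [NormedRing B] [NormedAlgebra ℂ B]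
    [CompleteSpace B] (S : Subalgebra ℂ B) {x : S} (hx : x ∈ Ring.jacobson S) {ε : ℝ}
    (hε : 0 < ε) : ∀ᶠ n : ℕ in Filter.atTop, ‖(x : B) ^ n‖ ≤ ε ^ n := by
  have hspec : ∀ z ∈ spectrum ℂ (x : B), z = 0 := by
    intro z hz
    by_contra h0
    refine hz ?_
    have h1 : IsUnit (1 - z⁻¹ • x) := by
      refine Ring.isUnit_one_sub_of_mem_jacobson ?_
      rw [← one_mul x, ← smul_mul_assoc]
      exact Ideal.mul_mem_left _ _ hx
    have h2 := h1.map S.val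
    have e : algebraMap ℂ B z - x = algebraMap ℂ B z * S.val (1 - z⁻¹ • x) := by
      rw [map_sub, map_one, map_smul, mul_sub, mul_one, Subalgebra.coe_val,
        Algebra.algebraMap_eq_smul_one, smul_mul_smul_comm, mul_inv_cancel₀ h0, one_mul, one_smul]
    rw [spectrum.mem_resolventSet_iff, e]
    exact ((IsUnit.mk0 z h0).map (algebraMap ℂ B)).mul h2
  have hr : spectralRadius ℂ (x : B) = 0 := by
    refine le_antisymm (iSup₂_le fun z hz => ?_) zero_le
    rw [hspec z hz]
    simp
  have ht := spectrum.pow_norm_pow_one_div_tendsto_nhds_spectralRadius (x : B)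
  rw [hr] at ht
  filter_upwards [ht.eventually_lt_const (ENNReal.ofReal_pos.2 hε), Filter.eventually_gt_atTop 0]
    with n hn hn0
  rw [ENNReal.ofReal_lt_ofReal_iff hε] at hn
  have := pow_le_pow_left₀ (by positivity) hn.le n
  rwa [one_div, Real.rpow_inv_natCast_pow (norm_nonneg _) hn0.ne'] at this

/-! ### Operators graded by length -/

namespace DegreeFunctor

open CatPath

variable {V : Type u} [Category.{v} V] {k : ℕ} (φ : DegreeFunctor V k)

/-- The operator `A` raises lengths by at least `d`: it maps functions supported on paths of length
at least `n` to functions supported on paths of length at least `n + d`. -/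
def Raises (d : ℕ) (A : Fock V →L[ℂ] Fock V) : Prop :=
  ∀ (n : ℕ) (f : Fock V), (∀ κ, φ.length κ < n → f κ = 0) →
    ∀ κ, φ.length κ < n + d → A f κ = 0

variable {φ}

theorem Raises.zero (d : ℕ) : φ.Raises d 0 := fun _ _ _ κ _ => by simp

theorem Raises.add {d : ℕ} {A B : Fock V →L[ℂ] Fock V} (hA : φ.Raises d A) (hB : φ.Raises d B) :
    φ.Raises d (A + B) := fun n f hf κ hκ => by
  simp [hA n f hf κ hκ, hB n f hf κ hκ]

theorem Raises.smul {d : ℕ} {A : Fock V →L[ℂ] Fock V} (hA : φ.Raises d A) (c : ℂ) :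
    φ.Raises d (c • A) := fun n f hf κ hκ => by
  simp [hA n f hf κ hκ]

theorem Raises.mul {d e : ℕ} {A B : Fock V →L[ℂ] Fock V} (hA : φ.Raises d A)
    (hB : φ.Raises e B) : φ.Raises (d + e) (A * B) := fun n f hf κ hκ =>
  hA (n + e) (B f) (hB n f hf) κ (by omega)

theorem Raises.one : φ.Raises 0 1 := fun _ _ hf κ hκ => hf κ hκ

theorem Raises.pow {d : ℕ} {A : Fock V →L[ℂ] Fock V} (hA : φ.Raises d A) (n : ℕ) :
    φ.Raises (n * d) (A ^ n) := by
  induction n with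
  | zero => simpa using Raises.one
  | succ n ih =>
    rw [pow_succ, Nat.succ_mul]
    exact ih.mul hA

theorem Raises.mono {d e : ℕ} {A : Fock V →L[ℂ] Fock V} (hA : φ.Raises e A) (h : d ≤ e) :
    φ.Raises d A := fun n f hf κ hκ => hA n f hf κ (by omega)

theorem raises_of_ξ {d : ℕ} {A : Fock V →L[ℂ] Fock V}
    (hA : ∀ ν κ, φ.length κ < φ.length ν + d → A (ξ ν) κ = 0) : φ.Raises d A := by
  intro n f hf κ hκ
  have h := hasSum_apply A f κ
  have h0 : (fun ν => f ν * A (ξ ν) κ) = fun _ => 0 := by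
    funext ν
    by_cases hν : φ.length ν < n
    · rw [hf ν hν, zero_mul]
    · rw [hA ν κ (by omega), mul_zero]
  rw [h0] at h
  exact h.unique hasSum_zero

theorem Raises.apply_ξ {d : ℕ} {A : Fock V →L[ℂ] Fock V} (hA : φ.Raises d A) {ν κ : CatPath V}
    (h : φ.length κ < φ.length ν + d) : A (ξ ν) κ = 0 :=
  hA (φ.length ν) (ξ ν) (fun η hη => ξ_apply_of_ne fun e => by simp [e] at hη) κ h

theorem raises_L [IsCategoryOfPaths V] (μ : CatPath V) : φ.Raises (φ.length μ) (L μ) := by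
  refine raises_of_ξ fun ν κ hκ => ?_
  refine L_ξ_apply_of_forall_ne μ ν κ fun h e => ?_
  rw [← e, φ.length_mul] at hκ
  omega

variable (φ) in
/-- The span over `K` of the operators `L_w` with `|w| = d`. -/
noncomputable def homogeneous (K : Type*) [CommSemiring K] [Algebra K (Fock V →L[ℂ] Fock V)] (d : ℕ) :
    Submodule K (Fock V →L[ℂ] Fock V) :=
  Submodule.span K {A | ∃ w : CatPath V, φ.length w = d ∧ A = L w}

section Homogeneous

variable {K : Type*} [CommSemiring K] [Algebra K (Fock V →L[ℂ] Fock V)]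

theorem L_mem_homogeneous (w : CatPath V) : L w ∈ φ.homogeneous K (φ.length w) :=
  Submodule.subset_span ⟨w, rfl, rfl⟩

theorem mul_mem_homogeneous [IsCategoryOfPaths V] {d e : ℕ} {A B : Fock V →L[ℂ] Fock V}
    (hA : A ∈ φ.homogeneous K d) (hB : B ∈ φ.homogeneous K e) :
    A * B ∈ φ.homogeneous K (d + e) := by
  refine Submodule.span_induction₂ (p := fun A B _ _ => A * B ∈ φ.homogeneous K (d + e))
    ?_ ?_ ?_ ?_ ?_ ?_ ?_ hA hB
  · rintro _ _ ⟨w, rfl, rfl⟩ ⟨z, rfl, rfl⟩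
    by_cases h : w.source = z.range
    · rw [L_mul_L w z h, ← φ.length_mul w z h]
      exact L_mem_homogeneous _
    · rw [L_mul_L_of_ne w z h]
      exact zero_mem _
  · intro y _
    rw [zero_mul]
    exact zero_mem _
  · intro x _
    rw [mul_zero]
    exact zero_mem _
  · intro x y z _ _ _ h₁ h₂
    rw [add_mul]
    exact add_mem h₁ h₂
  · intro x y z _ _ _ h₁ h₂
    rw [mul_add]
    exact add_mem h₁ h₂
  · intro r x y _ _ h
    rw [smul_mul_assoc]
    exact Submodule.smul_mem _ r h
  · intro r x y _ _ h
    rw [mul_smul_comm]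
    exact Submodule.smul_mem _ r h

theorem pow_mem_homogeneous [IsCategoryOfPaths V] {d : ℕ} {A : Fock V →L[ℂ] Fock V}
    (hA : A ∈ φ.homogeneous K d) {n : ℕ} (hn : n ≠ 0) : A ^ n ∈ φ.homogeneous K (n * d) := by
  obtain ⟨n, rfl⟩ := Nat.exists_eq_succ_of_ne_zero hn
  clear hn
  induction n with
  | zero => simpa using hA
  | succ n ih =>
    rw [pow_succ, Nat.succ_mul]
    exact mul_mem_homogeneous ih hA

end Homogeneous

theorem raises_of_mem_homogeneous [IsCategoryOfPaths V] {d : ℕ} {A : Fock V →L[ℂ] Fock V}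
    (hA : A ∈ φ.homogeneous ℂ d) : φ.Raises d A := by
  induction hA using Submodule.span_induction with
  | mem A h =>
    obtain ⟨w, rfl, rfl⟩ := h
    exact raises_L w
  | zero => exact Raises.zero d
  | add A B _ _ hA hB => exact hA.add hB
  | smul c A _ hA => exact hA.smul c

theorem apply_ξ_of_mem_homogeneous [IsCategoryOfPaths V] {d : ℕ} {A : Fock V →L[ℂ] Fock V}
    (hA : A ∈ φ.homogeneous ℂ d) {ν κ : CatPath V} (h : φ.length κ ≠ φ.length ν + d) :
    A (ξ ν) κ = 0 := by
  induction hA using Submodule.span_induction with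
  | mem A hw =>
    obtain ⟨w, rfl, rfl⟩ := hw
    refine L_ξ_apply_of_forall_ne w ν κ fun hs e => h ?_
    rw [← e, φ.length_mul, add_comm]
  | zero => rfl
  | add A B _ _ hA hB => simp [hA, hB]
  | smul c A _ hA => simp [hA]

theorem mem_freeSemigroupoidAlgebra_of_mem_homogeneous {d : ℕ} {A : Fock V →L[ℂ] Fock V}
    (hA : A ∈ φ.homogeneous ℂ d) : A ∈ freeSemigroupoidAlgebra V := by
  have h : φ.homogeneous ℂ d ≤ Subalgebra.toSubmodule (freeSemigroupoidAlgebra V) := by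
    refine Submodule.span_le.2 ?_
    rintro _ ⟨w, -, rfl⟩
    exact L_mem_freeSemigroupoidAlgebra w
  exact h hA

/-- The second half of property (P), for elements of the span of the `L_w` with `|w| = d`. -/
theorem PropertyP.exists_not_isNilpotent (hP : φ.PropertyP) {d : ℕ}
    {A : Fock V →L[ℂ] Fock V} (hA : A ∈ φ.homogeneous ℂ d) (h0 : A ≠ 0) :
    ∃ μ : CatPath V, ¬ IsNilpotent (L μ * A) := by
  obtain ⟨n, a, g, rfl⟩ := Submodule.mem_span_set'.1 hA
  choose w hw e using fun i => (g i).2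
  simp only [e] at h0 ⊢
  exact hP.exists_not_nilpotent n a w (fun i j => (hw i).trans (hw j).symm) h0

/-- Truncation: the lowest homogeneous part of `A` is dominated by `A` on the basis vectors. -/
theorem norm_apply_ξ_le_of_raises [IsCategoryOfPaths V] {d : ℕ} {A D : Fock V →L[ℂ] Fock V}
    (hD : D ∈ φ.homogeneous ℂ d) (h : φ.Raises (d + 1) (A - D)) (ν : CatPath V) :
    ‖D (ξ ν)‖ ≤ ‖A (ξ ν)‖ := by
  refine lp.norm_mono (by norm_num) fun κ => ?_
  by_cases hκ : φ.length κ = φ.length ν + d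
  · have := h.apply_ξ (ν := ν) (κ := κ) (by omega)
    have e : A (ξ ν) κ - D (ξ ν) κ = 0 := this
    rw [sub_eq_zero.1 e]
  · rw [apply_ξ_of_mem_homogeneous hD hκ, norm_zero]
    exact norm_nonneg _

theorem Raises.pow_sub_pow [IsCategoryOfPaths V] {d : ℕ} {A D : Fock V →L[ℂ] Fock V}
    (hD : φ.Raises d D) (h : φ.Raises (d + 1) (A - D)) (n : ℕ) :
    φ.Raises (n * d + 1) (A ^ n - D ^ n) := by
  have hA : φ.Raises d A := by
    have := (h.mono (Nat.le_succ d)).add hD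
    rwa [sub_add_cancel] at this
  induction n with
  | zero => simpa using Raises.zero (φ := φ) 1
  | succ n ih =>
    have e : A ^ (n + 1) - D ^ (n + 1) = A * (A ^ n - D ^ n) + (A - D) * D ^ n := by
      rw [pow_succ', pow_succ']
      noncomm_ring
    rw [e]
    exact ((hA.mul ih).mono (by rw [Nat.succ_mul]; omega)).add
      ((h.mul (hD.pow n)).mono (by rw [Nat.succ_mul]; omega))

/-! ### Leading terms of elements of the radical -/

variable (φ) in
/-- The operators that occur, up to terms of length greater than `d`, as the part of length `d` of
an element of the radical. -/
def IsLeading (d : ℕ) (D : Fock V →L[ℂ] Fock V) : Prop :=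
  D ∈ φ.homogeneous ℂ d ∧
    ∃ C ∈ Ring.jacobson (freeSemigroupoidAlgebra V), φ.Raises (d + 1) ((C : _) - D)

theorem IsLeading.smul {d : ℕ} {D : Fock V →L[ℂ] Fock V} (hD : φ.IsLeading d D) (c : ℂ) :
    φ.IsLeading d (c • D) := by
  obtain ⟨h, C, hC, hr⟩ := hD
  refine ⟨Submodule.smul_mem _ c h, c • C, ?_, ?_⟩
  · rw [← one_mul C, ← smul_mul_assoc]
    exact Ideal.mul_mem_left _ _ hC
  · have := hr.smul c
    rwa [smul_sub] at this

theorem IsLeading.sub {d : ℕ} {D E : Fock V →L[ℂ] Fock V} (hD : φ.IsLeading d D)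
    (hE : φ.IsLeading d E) : φ.IsLeading d (D - E) := by
  obtain ⟨h, C, hC, hr⟩ := hD
  obtain ⟨h', C', hC', hr'⟩ := hE
  refine ⟨sub_mem h h', C - C', sub_mem hC hC', ?_⟩
  have := hr.add (hr'.smul (-1))
  convert this using 1
  push_cast
  module

theorem IsLeading.mul_left [IsCategoryOfPaths V] {d e : ℕ} {B D : Fock V →L[ℂ] Fock V}
    (hB : B ∈ φ.homogeneous ℂ e) (hD : φ.IsLeading d D) : φ.IsLeading (e + d) (B * D) := by
  obtain ⟨h, C, hC, hr⟩ := hD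
  refine ⟨mul_mem_homogeneous hB h,
    ⟨B, mem_freeSemigroupoidAlgebra_of_mem_homogeneous hB⟩ * C, Ideal.mul_mem_left _ _ hC, ?_⟩
  have := (raises_of_mem_homogeneous hB).mul hr
  rwa [mul_sub, ← add_assoc] at this

theorem IsLeading.mul_right [IsCategoryOfPaths V] {d e : ℕ} {B D : Fock V →L[ℂ] Fock V}
    (hD : φ.IsLeading d D) (hB : B ∈ φ.homogeneous ℂ e) : φ.IsLeading (d + e) (D * B) := by
  obtain ⟨h, C, hC, hr⟩ := hD
  refine ⟨mul_mem_homogeneous h hB,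
    C * ⟨B, mem_freeSemigroupoidAlgebra_of_mem_homogeneous hB⟩, Ideal.mul_mem_right _ _ hC, ?_⟩
  have := hr.mul (raises_of_mem_homogeneous hB)
  rwa [sub_mul, add_right_comm] at this

/-- Leading terms of the radical are quasinilpotent on the basis vectors. -/
theorem IsLeading.exists_norm_pow_apply_ξ_le [IsCategoryOfPaths V] {d : ℕ}
    {D : Fock V →L[ℂ] Fock V} (hD : φ.IsLeading d D) {ε : ℝ} (hε : 0 < ε) :
    ∃ N : ℕ, ∀ n ≥ N, ∀ ν, ‖(D ^ n) (ξ ν)‖ ≤ ε ^ n := by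
  obtain ⟨h, C, hC, hr⟩ := hD
  obtain ⟨N, hN⟩ := Filter.eventually_atTop.1 (eventually_norm_pow_le_of_mem_jacobson _ hC hε)
  refine ⟨max N 1, fun n hn ν => ?_⟩
  have h1 := norm_apply_ξ_le_of_raises (pow_mem_homogeneous h (n := n) (by omega))
    ((raises_of_mem_homogeneous h).pow_sub_pow hr n) ν
  calc ‖(D ^ n) (ξ ν)‖ ≤ ‖((C : Fock V →L[ℂ] Fock V) ^ n) (ξ ν)‖ := h1
    _ ≤ ‖(C : Fock V →L[ℂ] Fock V) ^ n‖ * ‖ξ ν‖ := ContinuousLinearMap.le_opNorm _ _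
    _ ≤ ε ^ n := by rw [norm_ξ, mul_one]; exact hN n (by omega)

end DegreeFunctor

/-! ### Gaussian integers -/

/-- The Gaussian integers, as a subring of the complex numbers. -/
noncomputable abbrev gaussianSubring : Subring ℂ := GaussianInt.toComplex.range

theorem eq_zero_of_mem_gaussianSubring {z : ℂ} (hz : z ∈ gaussianSubring) (h : ‖z‖ < 1) :
    z = 0 := by
  obtain ⟨x, rfl⟩ := hz
  have h1 : Complex.normSq (x : ℂ) < 1 := by
    rw [Complex.normSq_eq_norm_sq]
    exact pow_lt_one₀ (norm_nonneg _) h two_ne_zero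
  rw [← GaussianInt.intCast_real_norm] at h1
  have h2 : x.norm < 1 := by exact_mod_cast h1
  have h3 : x.norm = 0 := le_antisymm (by omega) (GaussianInt.norm_nonneg x)
  rw [GaussianInt.norm_eq_zero.1 h3, map_zero]

theorem exists_mem_gaussianSubring_norm_sub_le (z : ℂ) :
    ∃ q ∈ gaussianSubring, ‖z - q‖ ≤ 2 := by
  refine ⟨(⟨round z.re, round z.im⟩ : GaussianInt), ⟨_, rfl⟩, ?_⟩
  refine (Complex.norm_le_abs_re_add_abs_im _).trans ?_
  have h1 := abs_sub_round z.re
  have h2 := abs_sub_round z.im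
  rw [Complex.sub_re, Complex.sub_im, GaussianInt.re_toComplex, GaussianInt.im_toComplex]
  linarith

/-- Simultaneous approximation: a line in a finite-dimensional complex space contains points that
are as close as desired to nonzero Gaussian integer vectors. -/
theorem exists_gaussian_approx {ι : Type*} (s : Finset ι) (β : ι → ℂ) {j₀ : ι} (hj₀ : j₀ ∈ s)
    (hβ : β j₀ ≠ 0) {ε : ℝ} (hε : 0 < ε) :
    ∃ (c : ℂ) (q : ι → ℂ), (∀ j, q j ∈ gaussianSubring) ∧ (∀ j ∈ s, ‖q j - c * β j‖ < ε) ∧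
      q j₀ ≠ 0 := by
  -- Two multiples `m γ`, `n γ` of `γ = β / β_{j₀}` have nearly the same residues modulo the
  -- Gaussian integers; the difference of the Gaussian integers next to them is the vector `q`.
  let γ : ι → ℂ := fun j => (β j₀)⁻¹ * β j
  choose p hp hpn using exists_mem_gaussianSubring_norm_sub_le
  let x : ℕ → (s → ℂ) := fun n j => n * γ j - p (n * γ j)
  have hx : ∀ n, x n ∈ Metric.closedBall (0 : s → ℂ) 2 := fun n => by
    rw [mem_closedBall_zero_iff, pi_norm_le_iff_of_nonneg zero_le_two]
    exact fun j => hpn _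
  obtain ⟨a, -, θ, hθ, ha⟩ := tendsto_subseq_of_bounded Metric.isBounded_closedBall hx
  obtain ⟨N, hN⟩ := Metric.cauchySeq_iff.1 ha.cauchySeq (min ε 1) (lt_min hε one_pos)
  have hlt : θ N < θ (N + 1) := hθ (Nat.lt_succ_self N)
  have hd := hN (N + 1) (Nat.le_succ N) N le_rfl
  let m : ℂ := (θ (N + 1) : ℂ) - θ N
  let q : ι → ℂ := fun j => p (θ (N + 1) * γ j) - p (θ N * γ j)
  have hq : ∀ j ∈ s, ‖q j - m * (β j₀)⁻¹ * β j‖ < min ε 1 := by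
    intro j hj
    have h1 := (dist_le_pi_dist _ _ (⟨j, hj⟩ : s)).trans_lt hd
    rw [dist_comm, dist_eq_norm] at h1
    have e : p (θ (N + 1) * γ j) - p (θ N * γ j) - ((θ (N + 1) : ℂ) - θ N) * (β j₀)⁻¹ * β j
      = (θ N * γ j - p (θ N * γ j)) - (θ (N + 1) * γ j - p (θ (N + 1) * γ j)) := by
      simp only [γ]
      ring
    exact (congrArg norm e).trans_lt h1
  refine ⟨m * (β j₀)⁻¹, q, fun j => sub_mem (hp _) (hp _),
    fun j hj => (hq j hj).trans_le (min_le_left _ _), fun h0 => ?_⟩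
  have h1 := (hq j₀ hj₀).trans_le (min_le_right _ _)
  rw [h0, mul_assoc, inv_mul_cancel₀ hβ, mul_one, zero_sub, norm_neg] at h1
  have h2 : m = ((θ (N + 1) - θ N : ℕ) : ℂ) := by
    rw [Nat.cast_sub hlt.le]
  rw [h2, Complex.norm_natCast] at h1
  have h3 : θ (N + 1) - θ N < 1 := by exact_mod_cast h1
  omega

/-! ### Semisimplicity from property (P) -/

namespace DegreeFunctor

open CatPath

variable {V : Type u} [Category.{v} V] {k : ℕ} {φ : DegreeFunctor V k}

theorem mem_homogeneous_of_gaussian {d : ℕ} {A : Fock V →L[ℂ] Fock V}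
    (hA : A ∈ φ.homogeneous gaussianSubring d) : A ∈ φ.homogeneous ℂ d :=
  Submodule.span_le_restrictScalars gaussianSubring ℂ _ hA

theorem apply_ξ_mem_gaussianSubring [IsCategoryOfPaths V] {d : ℕ} {A : Fock V →L[ℂ] Fock V}
    (hA : A ∈ φ.homogeneous gaussianSubring d) (ν κ : CatPath V) :
    A (ξ ν) κ ∈ gaussianSubring := by
  induction hA using Submodule.span_induction with
  | mem A hw =>
    obtain ⟨w, -, rfl⟩ := hw
    by_cases hs : w.source = ν.range
    · rw [L_ξ w ν hs]
      by_cases hκ : κ = w.mul ν hs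
      · rw [hκ, ξ_apply_self]
        exact one_mem _
      · rw [ξ_apply_of_ne hκ]
        exact zero_mem _
    · rw [L_ξ_of_ne w ν hs]
      exact zero_mem _
  | zero => exact zero_mem _
  | add A B _ _ hA hB => exact add_mem hA hB
  | smul c A _ hA => exact mul_mem c.2 hA

/-- The image of a basis vector under a Gaussian integer combination of the `L_w` has Gaussian
integer coordinates, hence norm at least one unless it vanishes. -/
theorem eq_zero_of_norm_apply_ξ_lt_one [IsCategoryOfPaths V] {d : ℕ} {A : Fock V →L[ℂ] Fock V}
    (hA : A ∈ φ.homogeneous gaussianSubring d) (h : ∀ ν, ‖A (ξ ν)‖ < 1) : A = 0 := by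
  refine ext_ξ fun ν => ?_
  ext κ
  exact eq_zero_of_mem_gaussianSubring (apply_ξ_mem_gaussianSubring hA ν κ)
    ((lp.norm_apply_le_norm (by norm_num) _ κ).trans_lt (h ν))

/-- A Gaussian integer combination of the `L_w` is nilpotent if it is the sum of a leading term of
the radical and of a small operator that commutes with it. -/
theorem IsLeading.isNilpotent_add [IsCategoryOfPaths V] {d : ℕ} {T E : Fock V →L[ℂ] Fock V}
    (hT : φ.IsLeading d T) (hE : ‖E‖ ≤ 1 / 4) (hc : Commute E T)
    (hG : E + T ∈ φ.homogeneous gaussianSubring d) : IsNilpotent (E + T) := by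
  obtain ⟨N, hN⟩ := hT.exists_norm_pow_apply_ξ_le (ε := 1 / 4) (by norm_num)
  -- The finitely many powers of `T` that the estimate does not cover cost a constant factor.
  obtain ⟨K, hK0, hK⟩ : ∃ K : ℝ, 0 < K ∧ ∀ n ν, ‖(T ^ n) (ξ ν)‖ ≤ K * (1 / 4) ^ n := by
    let K : ℝ := 1 + ∑ n ∈ Finset.range N, ‖T ^ n‖ * 4 ^ n
    have h0 : 0 ≤ ∑ n ∈ Finset.range N, ‖T ^ n‖ * 4 ^ n :=
      Finset.sum_nonneg fun n _ => by positivity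
    refine ⟨K, by positivity, fun n ν => ?_⟩
    rcases lt_or_ge n N with hn | hn
    · have h1 : ‖T ^ n‖ * 4 ^ n ≤ K := by
        have := Finset.single_le_sum (f := fun n => ‖T ^ n‖ * 4 ^ n)
          (fun n _ => by positivity) (Finset.mem_range.2 hn)
        exact this.trans (le_add_of_nonneg_left zero_le_one)
      calc ‖(T ^ n) (ξ ν)‖ ≤ ‖T ^ n‖ * ‖ξ ν‖ := ContinuousLinearMap.le_opNorm _ _
        _ = ‖T ^ n‖ * 4 ^ n * (1 / 4) ^ n := by
          rw [norm_ξ, mul_one, mul_assoc, ← mul_pow]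
          norm_num
        _ ≤ K * (1 / 4) ^ n := by gcongr
    · refine (hN n hn ν).trans ?_
      have : 1 ≤ K := by simp only [K]; linarith
      nlinarith [pow_pos (show (0 : ℝ) < 1 / 4 by norm_num) n]
  have hbound : ∀ n ν, ‖((E + T) ^ n) (ξ ν)‖ ≤ K * (1 / 2) ^ n := by
    intro n ν
    have e : ((1 : ℝ) / 2) ^ n
        = ∑ m ∈ Finset.range (n + 1), (1 / 4) ^ m * (1 / 4) ^ (n - m) * (n.choose m : ℝ) := by
      rw [← add_pow]
      norm_num
    rw [hc.add_pow, sum_apply, e, Finset.mul_sum]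
    refine (norm_sum_le _ _).trans (Finset.sum_le_sum fun m _ => ?_)
    have e2 : (E ^ m * T ^ (n - m) * ((n.choose m : ℕ) : Fock V →L[ℂ] Fock V)) (ξ ν)
        = (n.choose m : ℂ) • (E ^ m) ((T ^ (n - m)) (ξ ν)) := by
      rw [← nsmul_eq_mul', ← Nat.cast_smul_eq_nsmul ℂ]
      rfl
    rw [e2, norm_smul, Complex.norm_natCast]
    have : Nontrivial (Fock V) := ⟨ξ ν, 0, ξ_ne_zero ν⟩
    calc (n.choose m : ℝ) * ‖(E ^ m) ((T ^ (n - m)) (ξ ν))‖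
        ≤ n.choose m * (‖E‖ ^ m * (K * (1 / 4) ^ (n - m))) := by
          refine mul_le_mul_of_nonneg_left ((ContinuousLinearMap.le_opNorm _ _).trans ?_)
            (Nat.cast_nonneg _)
          exact mul_le_mul (norm_pow_le E m) (hK _ _) (norm_nonneg _) (by positivity)
      _ ≤ n.choose m * ((1 / 4) ^ m * (K * (1 / 4) ^ (n - m))) := by gcongr
      _ = K * ((1 / 4) ^ m * (1 / 4) ^ (n - m) * n.choose m) := by ring
  obtain ⟨n, hn⟩ := exists_pow_lt_of_lt_one (show 0 < 1 / K by positivity)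
    (show (1 / 2 : ℝ) < 1 by norm_num)
  have hlt : ∀ ν, ‖((E + T) ^ (n + 1)) (ξ ν)‖ < 1 := fun ν => by
    refine (hbound (n + 1) ν).trans_lt ?_
    rw [lt_div_iff₀ hK0] at hn
    have := pow_pos (show (0 : ℝ) < 1 / 2 by norm_num) n
    rw [pow_succ]
    nlinarith
  exact ⟨n + 1, eq_zero_of_norm_apply_ξ_lt_one (pow_mem_homogeneous hG n.succ_ne_zero) hlt⟩

variable (φ) in
/-- There is a nonzero leading term of the radical that is a complex combination of `n` operators,
each of which is a Gaussian integer combination of the `L_w` with `|w|` fixed. -/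
def HasLeadingSum (n : ℕ) : Prop :=
  ∃ (d : ℕ) (s : Finset (CatPath V)) (β : CatPath V → ℂ) (y : CatPath V → Fock V →L[ℂ] Fock V),
    s.card = n ∧ (∀ j ∈ s, y j ∈ φ.homogeneous gaussianSubring d) ∧
      φ.IsLeading d (∑ j ∈ s, β j • y j) ∧ ∑ j ∈ s, β j • y j ≠ 0

/-- The compression of `A` to the range `x` has the leading term `∑ a_w L_w`, where `w` runs
through the paths of length `d` with range `x` and `a_w` are the Fourier coefficients, provided that
there are no Fourier coefficients at shorter paths. -/
theorem raises_L_vertex_mul_sub [IsCategoryOfPaths V] {A : Fock V →L[ℂ] Fock V}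
    (hA : A ∈ freeSemigroupoidAlgebra V) {d : ℕ} {x : V} {W : Finset (CatPath V)}
    (hW : ∀ w, w ∈ W ↔ w.range = x ∧ φ.length w = d)
    (hmin : ∀ w : CatPath V, φ.length w < d → A (ξ (vertex w.source)) w = 0) :
    φ.Raises (d + 1) (L (vertex x) * A - ∑ w ∈ W, A (ξ (vertex w.source)) w • L w) := by
  classical
  have hzero : ∀ ν κ : CatPath V, (∀ (w : CatPath V) (h : w.source = ν.range), w ∈ W →
      w.mul ν h ≠ κ) → (∑ w ∈ W, A (ξ (vertex w.source)) w • L w) (ξ ν) κ = 0 := by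
    intro ν κ h
    rw [sum_smul_L_apply]
    refine Finset.sum_eq_zero fun w hw => ?_
    rw [L_ξ_apply_of_forall_ne w ν κ fun hs => h w hs hw, mul_zero]
  refine raises_of_ξ fun ν κ hκ => ?_
  refine sub_eq_zero.2 (?_ : L (vertex x) (A (ξ ν)) κ
    = (∑ w ∈ W, A (ξ (vertex w.source)) w • L w) (ξ ν) κ)
  by_cases hr : κ.range = x
  · subst hr
    have e1 := L_apply_mul (vertex κ.range) κ rfl (A (ξ ν))
    rw [vertex_mul] at e1
    rw [e1]
    by_cases hκν : ∃ (w : CatPath V) (h : w.source = ν.range), w.mul ν h = κ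
    · obtain ⟨w, hw, rfl⟩ := hκν
      rw [φ.length_mul] at hκ
      rw [sum_smul_L_apply_mul, apply_ξ_mul hA]
      split_ifs with hwW
      · rfl
      · exact hmin w (lt_of_le_of_ne (by omega) fun e => hwW ((hW w).2 ⟨rfl, e⟩))
    · rw [hzero ν κ fun w hw _ e => hκν ⟨w, hw, e⟩,
        apply_ξ_of_forall_ne hA ν κ fun w hw e => hκν ⟨w, hw, e⟩]
  · rw [hzero ν κ fun w hw hwW e => hr (by rw [← e]; exact ((hW w).1 hwW).1)]
    exact L_apply_of_forall_ne _ _ _ fun η h e => hr (by rw [← e]; rfl)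

/-- A nonzero radical has nonzero leading terms. -/
theorem exists_hasLeadingSum [IsCategoryOfPaths V] (hφ : φ.NonDegenerate)
    (hfin : ∀ x : V, {μ : CatPath V | μ.range = x ∧ μ.IsMinimal}.Finite)
    (hJ : Ring.jacobson (freeSemigroupoidAlgebra V) ≠ ⊥) : ∃ n, φ.HasLeadingSum n := by
  classical
  obtain ⟨⟨A, hA⟩, hC, hC0⟩ := (Submodule.ne_bot_iff _).1 hJ
  have hex : ∃ d, ∃ w : CatPath V, φ.length w = d ∧ A (ξ (vertex w.source)) w ≠ 0 := by
    by_contra! h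
    refine hC0 (Subtype.ext (ext_ξ fun ν => ?_))
    ext κ
    by_cases hκ : ∃ (w : CatPath V) (h : w.source = ν.range), w.mul ν h = κ
    · obtain ⟨w, hw, rfl⟩ := hκ
      exact (apply_ξ_mul hA w ν hw).trans (h _ w rfl)
    · exact apply_ξ_of_forall_ne hA ν κ fun w hw e => hκ ⟨w, hw, e⟩
  obtain ⟨d, ⟨w₀, hw₀, hne⟩, hmin⟩ := Nat.findX hex
  obtain ⟨W, hW⟩ : ∃ W : Finset (CatPath V),
      ∀ w, w ∈ W ↔ w.range = w₀.range ∧ φ.length w = d :=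
    ⟨(hφ.finite_setOf_length_eq hfin d w₀.range).toFinset, fun w => Set.Finite.mem_toFinset _⟩
  have hr := raises_L_vertex_mul_sub hA hW fun w hw => by
    by_contra h
    exact hmin _ hw ⟨w, rfl, h⟩
  have hmem : ∀ (K : Type) [CommSemiring K] [Algebra K (Fock V →L[ℂ] Fock V)],
      ∀ w ∈ W, L w ∈ φ.homogeneous K d := fun K _ _ w hw => by
    rw [← ((hW w).1 hw).2]
    exact L_mem_homogeneous w
  have hlead : φ.IsLeading d (∑ w ∈ W, A (ξ (vertex w.source)) w • L w) := by
    refine ⟨sum_mem fun w hw => Submodule.smul_mem _ _ (hmem ℂ w hw),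
      ⟨L (vertex w₀.range), L_mem_freeSemigroupoidAlgebra _⟩ * ⟨A, hA⟩, ?_, ?_⟩
    · exact Ideal.mul_mem_left _ _ hC
    · exact hr
  have hne0 : ∑ w ∈ W, A (ξ (vertex w.source)) w • L w ≠ 0 := fun h0 => by
    have h1 := sum_smul_L_apply_mul W (fun w => A (ξ (vertex w.source)) w) w₀
      (vertex w₀.source) rfl
    rw [h0, if_pos ((hW w₀).2 ⟨rfl, hw₀⟩)] at h1
    exact hne h1.symm
  exact ⟨W.card, d, W, fun w => A (ξ (vertex w.source)) w, L, rfl, hmem gaussianSubring,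
    hlead, hne0⟩

/-- In a leading term `D = ∑ β_j y_j` with as few summands as possible, `D u y_j = y_j u D` for
all `u`: the difference is a leading term in which the `j`-th summand has cancelled. -/
theorem mul_mul_eq_of_minimal [IsCategoryOfPaths V] {d : ℕ} {s : Finset (CatPath V)}
    {β : CatPath V → ℂ} {y : CatPath V → Fock V →L[ℂ] Fock V}
    (hmin : ∀ m < s.card, ¬ φ.HasLeadingSum m)
    (hy : ∀ j ∈ s, y j ∈ φ.homogeneous gaussianSubring d)
    (hD : φ.IsLeading d (∑ j ∈ s, β j • y j)) (u : CatPath V) {j : CatPath V} (hj : j ∈ s) :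
    (∑ i ∈ s, β i • y i) * L u * y j = y j * L u * ∑ i ∈ s, β i • y i := by
  classical
  by_contra hne
  have hyL := fun {i} (hi : i ∈ s) =>
    mul_mem_homogeneous (hy i hi) (L_mem_homogeneous (K := gaussianSubring) u)
  have e : (∑ i ∈ s, β i • y i) * L u * y j - y j * L u * ∑ i ∈ s, β i • y i
      = ∑ i ∈ s.erase j, β i • (y i * L u * y j - y j * L u * y i) := by
    rw [Finset.sum_erase _ (by rw [sub_self, smul_zero]), Finset.sum_mul, Finset.sum_mul,
      Finset.mul_sum, ← Finset.sum_sub_distrib]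
    refine Finset.sum_congr rfl fun i _ => ?_
    rw [smul_mul_assoc, smul_mul_assoc, mul_smul_comm, smul_sub]
  refine hmin _ (Finset.card_erase_lt_of_mem hj) ⟨d + φ.length u + d, s.erase j, β,
    fun i => y i * L u * y j - y j * L u * y i, rfl, fun i hi => ?_, ?_, ?_⟩
  · have hi' := Finset.mem_of_mem_erase hi
    exact sub_mem (mul_mem_homogeneous (hyL hi') (hy j hj))
      (mul_mem_homogeneous (hyL hj) (hy i hi'))
  · rw [← e]
    exact ((hD.mul_right (L_mem_homogeneous u)).mul_right
      (mem_homogeneous_of_gaussian (hy j hj))).sub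
        (hD.mul_left (mem_homogeneous_of_gaussian (hyL hj)))
  · rw [← e]
    exact sub_ne_zero.2 hne

/-- Property (P) makes the free semigroupoid algebra semisimple. -/
theorem PropertyP.jacobson_eq_bot [IsCategoryOfPaths V] (hP : φ.PropertyP)
    (hφ : φ.NonDegenerate) : Ring.jacobson (freeSemigroupoidAlgebra V) = ⊥ := by
  classical
  by_contra hJ
  have hex := exists_hasLeadingSum hφ hP.finite_minimal hJ
  obtain ⟨d, s, β, y, hcard, hy, hD, hD0⟩ := Nat.find_spec hex
  have hmin : ∀ m < s.card, ¬ φ.HasLeadingSum m := fun m hm => Nat.find_min hex (hcard ▸ hm)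
  have hcomm := fun u {j} (hj : j ∈ s) => mul_mul_eq_of_minimal hmin hy hD u hj
  set D := ∑ j ∈ s, β j • y j with hDdef
  obtain ⟨j₀, hj₀, hj₀'⟩ := Finset.exists_ne_zero_of_sum_ne_zero hD0
  have hβ : β j₀ ≠ 0 := fun h => hj₀' (by rw [h, zero_smul])
  obtain ⟨B, hB0, hB⟩ : ∃ B : ℝ, 0 < B ∧ ∑ j ∈ s, ‖y j‖ ≤ B :=
    ⟨1 + ∑ j ∈ s, ‖y j‖, by positivity, by linarith⟩
  obtain ⟨c, q, hq, hqβ, hq0⟩ := exists_gaussian_approx s β hj₀ hβ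
    (show 0 < 1 / (4 * B) by positivity)
  let Q : Fock V →L[ℂ] Fock V := ∑ j ∈ s, q j • y j
  let F : Fock V →L[ℂ] Fock V := ∑ j ∈ s, (q j - c * β j) • y j
  have hQF : Q = F + c • D := by
    simp only [Q, F, hDdef, Finset.smul_sum, ← Finset.sum_add_distrib]
    refine Finset.sum_congr rfl fun j _ => ?_
    module
  have hQmem : Q ∈ φ.homogeneous gaussianSubring d :=
    sum_mem fun j hj => Submodule.smul_mem _ (⟨q j, hq j⟩ : gaussianSubring) (hy j hj)
  have hF : ‖F‖ ≤ 1 / 4 := by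
    calc ‖F‖ ≤ ∑ j ∈ s, 1 / (4 * B) * ‖y j‖ := by
          refine (norm_sum_le _ _).trans (Finset.sum_le_sum fun j hj => ?_)
          rw [norm_smul]
          exact mul_le_mul_of_nonneg_right (hqβ j hj).le (norm_nonneg _)
      _ ≤ 1 / (4 * B) * B := by
          rw [← Finset.mul_sum]
          exact mul_le_mul_of_nonneg_left hB (by positivity)
      _ = 1 / 4 := by field_simp
  -- Every `L_μ Q` is close to a multiple of the leading term `L_μ D` and commutes with it.
  have hQ0 : Q = 0 := by
    by_contra h0
    obtain ⟨μ, hμ⟩ := hP.exists_not_isNilpotent (mem_homogeneous_of_gaussian hQmem) h0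
    refine hμ ?_
    have e : L μ * Q = L μ * F + c • (L μ * D) := by
      rw [hQF, mul_add, mul_smul_comm]
    rw [e]
    refine ((hD.mul_left (L_mem_homogeneous μ)).smul c).isNilpotent_add ?_ ?_ ?_
    · refine (norm_mul_le _ _).trans ?_
      have := norm_L_le μ
      nlinarith [norm_nonneg F]
    · have hDF : D * L μ * F = F * L μ * D := by
        simp only [F, Finset.mul_sum, Finset.sum_mul, smul_mul_assoc, mul_smul_comm]
        exact Finset.sum_congr rfl fun j hj => by rw [hcomm μ hj]
      refine Commute.smul_right ?_ c
      change L μ * F * (L μ * D) = L μ * D * (L μ * F)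
      calc L μ * F * (L μ * D) = L μ * (F * L μ * D) := by noncomm_ring
        _ = L μ * (D * L μ * F) := by rw [hDF]
        _ = L μ * D * (L μ * F) := by noncomm_ring
    · rw [← e]
      exact mul_mem_homogeneous (L_mem_homogeneous μ) hQmem
  -- The relation `Q = 0` eliminates the summand `y_{j₀}` from `D`.
  have e : q j₀ • D = ∑ j ∈ s.erase j₀, (q j₀ * β j - β j₀ * q j) • y j := by
    rw [Finset.sum_erase _ (by rw [mul_comm, sub_self, zero_smul])]
    have h1 : q j₀ • D = q j₀ • D - β j₀ • Q := by rw [hQ0, smul_zero, sub_zero]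
    rw [h1]
    simp only [Q, hDdef, Finset.smul_sum, ← Finset.sum_sub_distrib]
    refine Finset.sum_congr rfl fun j _ => ?_
    module
  refine hmin _ (Finset.card_erase_lt_of_mem hj₀) ⟨d, s.erase j₀, _, y, rfl,
    fun j hj => hy j (Finset.mem_of_mem_erase hj), e ▸ hD.smul (q j₀), ?_⟩
  rw [← e]
  exact smul_ne_zero hq0 hD0

end DegreeFunctor

/-! ### Paths on cycles -/

namespace CatPath

variable {V : Type u} [Category.{v} V]

/-- If the free semigroupoid algebra is semisimple, then every path lies on a cycle. -/
theorem liesOnCycle_of_jacobson_eq_bot [IsCategoryOfPaths V]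
    (h : Ring.jacobson (freeSemigroupoidAlgebra V) = ⊥) (μ : CatPath V) : μ.LiesOnCycle := by
  by_contra hμ
  have hmem : (⟨L μ, L_mem_freeSemigroupoidAlgebra μ⟩ : freeSemigroupoidAlgebra V)
      ∈ Ring.jacobson (freeSemigroupoidAlgebra V) :=
    Ring.mem_jacobson_of_forall_mul_mul_eq_zero fun A =>
      Subtype.ext (L_mul_mul_L_eq_zero hμ A.2)
  rw [h, Submodule.mem_bot] at hmem
  exact L_ne_zero μ (congrArg Subtype.val hmem)

end CatPath

theorem mainTheorem1 {V : Type u} [Category.{v} V] [IsCategoryOfPaths V] {k : ℕ}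
    (φ : DegreeFunctor V k) (hφ : φ.NonDegenerate) :
    (φ.PropertyP → Ring.jacobson (CatPath.freeSemigroupoidAlgebra V) = ⊥) ∧
    (Ring.jacobson (CatPath.freeSemigroupoidAlgebra V) = ⊥ →
      ∀ μ : CatPath V, μ.LiesOnCycle) :=
  ⟨fun hP => hP.jacobson_eq_bot hφ, CatPath.liesOnCycle_of_jacobson_eq_bot⟩
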